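/- **Theorem 4.7.** Throughout, all spaces are Banach spaces over a fixed scalar field $\mathbb K\in\{\mathbb R,\mathbb C\}$, $\mathcal L(E,F)$ denotes the bounded linear operators, $\mathcal F(E,F)$ those of finite rank, $\overline{\mathcal F}(E,F)$ the operator-norm closure of $\mathcal F(E,F)$, and $\operatorname{tr}$ the trace of a finite rank operator. A *Banach ideal* $(\mathcal A,\mathbf A)$ assigns to each pair $(E,F)$ of Banach spaces a linear subspace $\mathcal A(E,F)\subseteq\mathcal L(E,F)$ containing $\mathcal F(E,F)$, with a complete norm $\mathbf A$ on it, such that $\mathbf A(\mathrm{id}_{\mathbb K})=1$, and $STR\in\mathcal A$ with $\mathbf A(STR)\le\|S\|\,\mathbf A(T)\,\|R\|$ whenever $T\in\mathcal A$ and $R,S$ are bounded operators for which $STR$ is defined. For pairs $(\mathcal A,\mathbf A)$, $(\mathcal B,\mathbf B)$ of this kind: * $\mathcal A\overset{1}{=}\mathcal B$ (isometrically) means that $\mathcal A(E,F)=\mathcal B(E,F)$ with equal norms for all $E,F$. * $T\in\mathcal L(E,F)$ belongs to $\mathcal A\circ\mathcal B^{-1}$ if $TS\in\mathcal A(G,F)$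 for all $G$ and all $S\in\mathcal B(G,E)$, with norm $\sup\{\mathbf A(TS):\mathbf B(S)=1\}$; and to $\mathcal B^{-1}\circ\mathcal A$ if $ST\in\mathcal A(E,G)$ for all $G$ and all $S\in\mathcal B(F,G)$, with norm $\sup\{\mathbf A(ST):\mathbf B(S)=1\}$ (with $\sup\emptyset=0$). $\mathcal A$ is *maximal* if $\mathcal A\overset{1}{=}\overline{\mathcal F}^{-1}\circ(\mathcal A\circ\overline{\mathcal F}^{-1})$, where $\overline{\mathcal F}$ carries the operator norm. * The *adjoint* $(\mathcal A^*,\mathbf A^*)$: $T\in\mathcal A^*(E,F)$ if there is $c\ge0$ such that $|\operatorname{tr}(TPSQ)|\le c\,\|P\|\,\mathbf A(S)\,\|Q\|$ for all Banach spaces $E_0,F_0$ and all $P\in\mathcal F(E_0,E)$, $S\in\mathcal A(F_0,E_0)$, $Q\in\mathcal F(F,F_0)$; $\mathbf A^*(T)$ is the infimum of such $c$. * The *conjugate* $(\mathcal A^\Delta,\mathbf A^\Delta)$: $T\in\mathcal A^\Delta(E,F)$ if there is $c\ge0$ such that $|\operatorname{tr}(TL)|\le c\,\mathbf A(L)$ for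 all $L\in\mathcal F(F,E)$; $\mathbf A^\Delta(T)$ is the infimum of such $c$. * $\mathcal A$ is *right-accessible* if for every finite-dimensional $M$, every Banach space $F$, every $T\in\mathcal L(M,F)$ and $\varepsilon>0$ there are a finite-dimensional subspace $N\subseteq F$, with inclusion $J_N^F:N\to F$, and $S\in\mathcal A(M,N)$ with $T=J_N^FS$ and $\mathbf A(S)\le(1+\varepsilon)\mathbf A(T)$. * $\mathcal A$ is *left-accessible* if for every Banach space $E$, every finite-dimensional $N$, every $T\in\mathcal L(E,N)$ and $\varepsilon>0$ there are a closed subspace $K\subseteq E$ of finite codimension, with quotient map $Q_K^E:E\to E/K$, and $S\in\mathcal A(E/K,N)$ with $T=SQ_K^E$ and $\mathbf A(S)\le(1+\varepsilon)\mathbf A(T)$. $\mathcal A$ is *accessible* if it is both right- and left-accessible. * The *$\mathcal A$-extension property* holds if for every $\varepsilon>0$, every linear isometric embedding $J:E\to G$ and every $T\in\mathcal A(E,F)$ there is $\widetilde T\in\mathcal A(G,F)$ with $T=\widetilde TJ$ and $\mathbf A(\widetilde T)\le(1+\varepsilon)\mathbf A(T)$. Let $(\mathcal A,\mathbf A)$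 be a maximal and left-accessible Banach ideal such that the $\mathcal A^*$-extension property holds. Then $\mathcal A$ is accessible, and $$\mathcal A^{\Delta\Delta}\overset{1}{=}\mathcal A^{*\Delta},$$ that is, $(\mathcal A^\Delta)^\Delta$ and $(\mathcal A^*)^\Delta$ contain the same operators, with equal norms. -/

import Mathlib

universe u

noncomputable section

/-- A continuous linear operator with finite-dimensional range (an element of `𝓕(E, F)`). -/
def IsFiniteOp {𝕜 : Type u} [RCLike 𝕜] {E F : Type u}
    [NormedAddCommGroup E] [NormedSpace 𝕜 E] [NormedAddCommGroup F] [NormedSpace 𝕜 F]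
    (T : E →L[𝕜] F) : Prop :=
  FiniteDimensional 𝕜 (LinearMap.range (T : E →ₗ[𝕜] F))

/-- The trace of an operator of finite rank on a (possibly infinite-dimensional) space: the
trace of the endomorphism that it induces on its own finite-dimensional range. For
`T x = ∑ i, aᵢ(x) • yᵢ` it is `∑ i, aᵢ(yᵢ)`. -/
def finTrace {𝕜 : Type u} [RCLike 𝕜] {E : Type u}
    [NormedAddCommGroup E] [NormedSpace 𝕜 E] (T : E →L[𝕜] E) : 𝕜 :=
  LinearMap.trace 𝕜 (LinearMap.range (T : E →ₗ[𝕜] E))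
    ((T : E →ₗ[𝕜] E).rangeRestrict.comp (LinearMap.range (T : E →ₗ[𝕜] E)).subtype)

/-- A class of operators between Banach spaces (`mem T` means that `T` belongs to the class)
together with a number `nrm T`, which is meaningful only for `T` in the class. The laws of a
Banach ideal are added in `BanachIdeal`. -/
structure OpClass (𝕜 : Type u) [RCLike 𝕜] where
  mem : ∀ {E F : Type u} [NormedAddCommGroup E] [NormedSpace 𝕜 E] [CompleteSpace E]
    [NormedAddCommGroup F] [NormedSpace 𝕜 F] [CompleteSpace F], (E →L[𝕜] F) → Prop
  nrm : ∀ {E F : Type u} [NormedAddCommGroup E] [NormedSpace 𝕜 E] [CompleteSpace E]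
    [NormedAddCommGroup F] [NormedSpace 𝕜 F] [CompleteSpace F], (E →L[𝕜] F) → ℝ

/-- A Banach ideal `(𝒜, 𝐀)` of operators between Banach spaces over `𝕜`. -/
structure BanachIdeal (𝕜 : Type u) [RCLike 𝕜] extends OpClass 𝕜 where
  mem_of_isFiniteOp : ∀ {E F : Type u}
    [NormedAddCommGroup E] [NormedSpace 𝕜 E] [CompleteSpace E]
    [NormedAddCommGroup F] [NormedSpace 𝕜 F] [CompleteSpace F] (T : E →L[𝕜] F),
    IsFiniteOp T → mem T
  mem_add : ∀ {E F : Type u}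
    [NormedAddCommGroup E] [NormedSpace 𝕜 E] [CompleteSpace E]
    [NormedAddCommGroup F] [NormedSpace 𝕜 F] [CompleteSpace F] (S T : E →L[𝕜] F),
    mem S → mem T → mem (S + T)
  mem_smul : ∀ {E F : Type u}
    [NormedAddCommGroup E] [NormedSpace 𝕜 E] [CompleteSpace E]
    [NormedAddCommGroup F] [NormedSpace 𝕜 F] [CompleteSpace F] (c : 𝕜) (T : E →L[𝕜] F),
    mem T → mem (c • T)
  mem_comp : ∀ {D E F G : Type u}
    [NormedAddCommGroup D] [NormedSpace 𝕜 D] [CompleteSpace D]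
    [NormedAddCommGroup E] [NormedSpace 𝕜 E] [CompleteSpace E]
    [NormedAddCommGroup F] [NormedSpace 𝕜 F] [CompleteSpace F]
    [NormedAddCommGroup G] [NormedSpace 𝕜 G] [CompleteSpace G]
    (S : F →L[𝕜] G) (T : E →L[𝕜] F) (R : D →L[𝕜] E), mem T → mem (S.comp (T.comp R))
  /-- `𝐀` is a norm on each component `𝒜(E, F)`. -/
  nrm_add_le : ∀ {E F : Type u}
    [NormedAddCommGroup E] [NormedSpace 𝕜 E] [CompleteSpace E]
    [NormedAddCommGroup F] [NormedSpace 𝕜 F] [CompleteSpace F] (S T : E →L[𝕜] F),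
    mem S → mem T → nrm (S + T) ≤ nrm S + nrm T
  nrm_smul : ∀ {E F : Type u}
    [NormedAddCommGroup E] [NormedSpace 𝕜 E] [CompleteSpace E]
    [NormedAddCommGroup F] [NormedSpace 𝕜 F] [CompleteSpace F] (c : 𝕜) (T : E →L[𝕜] F),
    mem T → nrm (c • T) = ‖c‖ * nrm T
  eq_zero_of_nrm_eq_zero : ∀ {E F : Type u}
    [NormedAddCommGroup E] [NormedSpace 𝕜 E] [CompleteSpace E]
    [NormedAddCommGroup F] [NormedSpace 𝕜 F] [CompleteSpace F] (T : E →L[𝕜] F),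
    mem T → nrm T = 0 → T = 0
  /-- Each component `𝒜(E, F)` is complete for `𝐀`. -/
  complete : ∀ {E F : Type u}
    [NormedAddCommGroup E] [NormedSpace 𝕜 E] [CompleteSpace E]
    [NormedAddCommGroup F] [NormedSpace 𝕜 F] [CompleteSpace F] (s : ℕ → E →L[𝕜] F),
    (∀ n, mem (s n)) →
    (∀ ε : ℝ, 0 < ε → ∃ N : ℕ, ∀ m n : ℕ, N ≤ m → N ≤ n → nrm (s m - s n) < ε) →
    ∃ T : E →L[𝕜] F, mem T ∧
      ∀ ε : ℝ, 0 < ε → ∃ N : ℕ, ∀ n : ℕ, N ≤ n → nrm (s n - T) < ε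
  nrm_comp_le : ∀ {D E F G : Type u}
    [NormedAddCommGroup D] [NormedSpace 𝕜 D] [CompleteSpace D]
    [NormedAddCommGroup E] [NormedSpace 𝕜 E] [CompleteSpace E]
    [NormedAddCommGroup F] [NormedSpace 𝕜 F] [CompleteSpace F]
    [NormedAddCommGroup G] [NormedSpace 𝕜 G] [CompleteSpace G]
    (S : F →L[𝕜] G) (T : E →L[𝕜] F) (R : D →L[𝕜] E), mem T →
    nrm (S.comp (T.comp R)) ≤ ‖S‖ * nrm T * ‖R‖
  nrm_id : nrm (ContinuousLinearMap.id 𝕜 𝕜) = 1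

namespace OpClass

variable {𝕜 : Type u} [RCLike 𝕜]

/-- Isometric identity: the same operators belong to both classes, with the same norms. -/
def IsometricEq (A B : OpClass 𝕜) : Prop :=
  ∀ (E F : Type u) [NormedAddCommGroup E] [NormedSpace 𝕜 E] [CompleteSpace E]
    [NormedAddCommGroup F] [NormedSpace 𝕜 F] [CompleteSpace F] (T : E →L[𝕜] F),
    (A.mem T ↔ B.mem T) ∧ (A.mem T → A.nrm T = B.nrm T)

/-- The approximable operators, i.e. the operator-norm limits of finite operators, with the
operator norm. -/
def approximable (𝕜 : Type u) [RCLike 𝕜] : OpClass 𝕜 where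
  mem {E F} _ _ _ _ _ _ T := T ∈ closure {S : E →L[𝕜] F | IsFiniteOp S}
  nrm T := ‖T‖

/-- The right-`ℬ`-quotient `𝒜 ∘ ℬ⁻¹`. -/
def rightQuotient (A B : OpClass 𝕜) : OpClass 𝕜 where
  mem {E _} _ _ _ _ _ _ T :=
    ∀ (G : Type u) [NormedAddCommGroup G] [NormedSpace 𝕜 G] [CompleteSpace G]
      (S : G →L[𝕜] E), B.mem S → A.mem (T.comp S)
  nrm {E _} _ _ _ _ _ _ T :=
    sSup {r : ℝ | ∃ (G : Type u) (_ : NormedAddCommGroup G) (_ : NormedSpace 𝕜 G)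
      (_ : CompleteSpace G) (S : G →L[𝕜] E),
      B.mem S ∧ B.nrm S = 1 ∧ r = A.nrm (T.comp S)}

/-- The left-`ℬ`-quotient `ℬ⁻¹ ∘ 𝒜`. -/
def leftQuotient (B A : OpClass 𝕜) : OpClass 𝕜 where
  mem {_ F} _ _ _ _ _ _ T :=
    ∀ (G : Type u) [NormedAddCommGroup G] [NormedSpace 𝕜 G] [CompleteSpace G]
      (S : F →L[𝕜] G), B.mem S → A.mem (S.comp T)
  nrm {_ F} _ _ _ _ _ _ T :=
    sSup {r : ℝ | ∃ (G : Type u) (_ : NormedAddCommGroup G) (_ : NormedSpace 𝕜 G)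
      (_ : CompleteSpace G) (S : F →L[𝕜] G),
      B.mem S ∧ B.nrm S = 1 ∧ r = A.nrm (S.comp T)}

/-- The maximal hull: the left- and right-quotient by the approximable operators. -/
def maxHull (A : OpClass 𝕜) : OpClass 𝕜 :=
  leftQuotient (approximable 𝕜) (rightQuotient A (approximable 𝕜))

/-- `𝒜` is maximal if it agrees isometrically with its maximal hull. -/
def IsMaximal (A : OpClass 𝕜) : Prop := A.IsometricEq A.maxHull

/-- `c` is an admissible constant in the definition of the adjoint `𝒜*`. -/
def AdjointBound (A : OpClass 𝕜) {E F : Type u}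
    [NormedAddCommGroup E] [NormedSpace 𝕜 E] [CompleteSpace E]
    [NormedAddCommGroup F] [NormedSpace 𝕜 F] [CompleteSpace F]
    (T : E →L[𝕜] F) (c : ℝ) : Prop :=
  0 ≤ c ∧ ∀ (E₀ F₀ : Type u)
    [NormedAddCommGroup E₀] [NormedSpace 𝕜 E₀] [CompleteSpace E₀]
    [NormedAddCommGroup F₀] [NormedSpace 𝕜 F₀] [CompleteSpace F₀]
    (P : E₀ →L[𝕜] E) (S : F₀ →L[𝕜] E₀) (Q : F →L[𝕜] F₀),
    IsFiniteOp P → A.mem S → IsFiniteOp Q →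
    ‖finTrace (T.comp (P.comp (S.comp Q)))‖ ≤ c * ‖P‖ * A.nrm S * ‖Q‖

/-- The adjoint `𝒜*`. -/
def adjoint (A : OpClass 𝕜) : OpClass 𝕜 where
  mem T := ∃ c : ℝ, A.AdjointBound T c
  nrm T := sInf {c : ℝ | A.AdjointBound T c}

/-- `c` is an admissible constant in the definition of the conjugate `𝒜^Δ`. -/
def ConjugateBound (A : OpClass 𝕜) {E F : Type u}
    [NormedAddCommGroup E] [NormedSpace 𝕜 E] [CompleteSpace E]
    [NormedAddCommGroup F] [NormedSpace 𝕜 F] [CompleteSpace F]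
    (T : E →L[𝕜] F) (c : ℝ) : Prop :=
  0 ≤ c ∧ ∀ L : F →L[𝕜] E, IsFiniteOp L → ‖finTrace (T.comp L)‖ ≤ c * A.nrm L

/-- The conjugate `𝒜^Δ`. -/
def conjugate (A : OpClass 𝕜) : OpClass 𝕜 where
  mem T := ∃ c : ℝ, A.ConjugateBound T c
  nrm T := sInf {c : ℝ | A.ConjugateBound T c}

/-- Right-accessibility: every operator `T` from a finite-dimensional space `M` into a Banach
space `F` factors, with almost the same ideal norm, through the inclusion of a
finite-dimensional subspace `N` of `F`. -/
def IsRightAccessible (A : OpClass 𝕜) : Prop :=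
  ∀ (M F : Type u) [NormedAddCommGroup M] [NormedSpace 𝕜 M] [CompleteSpace M]
    [NormedAddCommGroup F] [NormedSpace 𝕜 F] [CompleteSpace F] [FiniteDimensional 𝕜 M]
    (T : M →L[𝕜] F) (ε : ℝ), 0 < ε →
    ∃ (N : Submodule 𝕜 F) (_ : FiniteDimensional 𝕜 N) (_ : CompleteSpace N)
      (S : M →L[𝕜] N), A.mem S ∧ T = N.subtypeL.comp S ∧ A.nrm S ≤ (1 + ε) * A.nrm T

/-- Left-accessibility: every operator `T` from a Banach space `E` into a finite-dimensional
space `N` factors, with almost the same ideal norm, through the quotient map of `E` onto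
`E ⧸ K` for a closed subspace `K` of finite codimension. -/
def IsLeftAccessible (A : OpClass 𝕜) : Prop :=
  ∀ (E N : Type u) [NormedAddCommGroup E] [NormedSpace 𝕜 E] [CompleteSpace E]
    [NormedAddCommGroup N] [NormedSpace 𝕜 N] [CompleteSpace N] [FiniteDimensional 𝕜 N]
    (T : E →L[𝕜] N) (ε : ℝ), 0 < ε →
    ∃ (K : Submodule 𝕜 E) (_ : IsClosed (K : Set E)) (_ : FiniteDimensional 𝕜 (E ⧸ K))
      (S : (E ⧸ K) →L[𝕜] N), A.mem S ∧ T = S.comp K.mkQL ∧ A.nrm S ≤ (1 + ε) * A.nrm T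

/-- Accessible: right- and left-accessible. -/
def IsAccessible (A : OpClass 𝕜) : Prop := A.IsRightAccessible ∧ A.IsLeftAccessible

/-- The `𝒜`-extension property. -/
def ExtensionProperty (A : OpClass 𝕜) : Prop :=
  ∀ (E F G : Type u) [NormedAddCommGroup E] [NormedSpace 𝕜 E] [CompleteSpace E]
    [NormedAddCommGroup F] [NormedSpace 𝕜 F] [CompleteSpace F]
    [NormedAddCommGroup G] [NormedSpace 𝕜 G] [CompleteSpace G]
    (ε : ℝ) (J : E →ₗᵢ[𝕜] G) (T : E →L[𝕜] F), 0 < ε → A.mem T →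
    ∃ T' : G →L[𝕜] F, A.mem T' ∧ T = T'.comp J.toContinuousLinearMap ∧
      A.nrm T' ≤ (1 + ε) * A.nrm T

end OpClass

end

/-!
Left accessibility lets the adjoint bound `𝐀*(T)` control `tr(TPL)` by `𝐀*(T) ‖P‖ 𝐀(L)` for every
finite operator `P`. If the domain of `T` has the metric approximation property, `P` can be chosen
close to the identity on the range of `L`, so `𝐀*(T)` bounds `tr(TL)` as well. Every Banach space
embeds isometrically into some `ℓ^∞(I)`, which has this property, and the extension property of
`𝒜*` transports the estimate back: `𝒜* = 𝒜^Δ` isometrically, and so `𝒜^{ΔΔ} = 𝒜^{*Δ}`.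

For right-accessibility, let `p(T)` be the infimum of the ideal norms of the factors of `T : M → F`
through finite-dimensional subspaces of `F`. This is a continuous seminorm, so by Hahn–Banach and
trace duality `p(T) = tr(UT)` for some `U : F → M` with `|tr(U ·)| ≤ p`. The latter bound gives
`𝐀*(U) ≤ 1`, hence `𝐀^Δ(U) ≤ 1` and `p(T) ≤ 𝐀(T)`.
-/

section FiniteTrace

variable {𝕜 : Type u} [RCLike 𝕜] {E F G : Type u}
  [NormedAddCommGroup E] [NormedSpace 𝕜 E] [NormedAddCommGroup F] [NormedSpace 𝕜 F]
  [NormedAddCommGroup G] [NormedSpace 𝕜 G]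

theorem IsFiniteOp.of_finiteDimensional_domain [FiniteDimensional 𝕜 E] (T : E →L[𝕜] F) :
    IsFiniteOp T :=
  inferInstanceAs (FiniteDimensional 𝕜 (LinearMap.range (T : E →ₗ[𝕜] F)))

theorem IsFiniteOp.of_finiteDimensional_codomain [FiniteDimensional 𝕜 F] (T : E →L[𝕜] F) :
    IsFiniteOp T :=
  inferInstanceAs (FiniteDimensional 𝕜 (LinearMap.range (T : E →ₗ[𝕜] F)))

theorem IsFiniteOp.postcomp {T : E →L[𝕜] F} (hT : IsFiniteOp T) (S : F →L[𝕜] G) :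
    IsFiniteOp (S.comp T) := by
  have : FiniteDimensional 𝕜 (LinearMap.range (T : E →ₗ[𝕜] F)) := hT
  have hrange : LinearMap.range ((S.comp T : E →L[𝕜] G) : E →ₗ[𝕜] G) =
      (LinearMap.range (T : E →ₗ[𝕜] F)).map (S : F →ₗ[𝕜] G) := LinearMap.range_comp _ _
  rw [IsFiniteOp, hrange]
  infer_instance

theorem IsFiniteOp.precomp {T : F →L[𝕜] G} (hT : IsFiniteOp T) (S : E →L[𝕜] F) :
    IsFiniteOp (T.comp S) :=
  have : FiniteDimensional 𝕜 (LinearMap.range (T : F →ₗ[𝕜] G)) := hT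
  Submodule.finiteDimensional_of_le
    (LinearMap.range_comp_le_range (S : E →ₗ[𝕜] F) (T : F →ₗ[𝕜] G))

theorem IsFiniteOp.exists_range_factor {T : E →L[𝕜] F} (hT : IsFiniteOp T) :
    ∃ (N : Submodule 𝕜 F) (_ : FiniteDimensional 𝕜 N) (_ : CompleteSpace N)
      (S : E →L[𝕜] N), T = N.subtypeL.comp S ∧ ‖S‖ ≤ ‖T‖ :=
  have : FiniteDimensional 𝕜 (LinearMap.range (T : E →ₗ[𝕜] F)) := hT
  ⟨_, hT, FiniteDimensional.complete 𝕜 _,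
    T.codRestrict _ (fun x => LinearMap.mem_range_self (T : E →ₗ[𝕜] F) x), rfl,
    ContinuousLinearMap.opNorm_le_bound _ (norm_nonneg T) fun x => T.le_opNorm x⟩

theorem sum_coord_smulRight [FiniteDimensional 𝕜 E] {ι : Type*} [Fintype ι]
    (b : Module.Basis ι 𝕜 E) (T : E →L[𝕜] F) :
    ∑ k, (b.coord k).toContinuousLinearMap.smulRight (T (b k)) = T := by
  ext x
  conv_rhs => rw [← b.sum_repr x, map_sum]
  simp

theorem IsFiniteOp.exists_eq_sum_smulRight {T : E →L[𝕜] F} (hT : IsFiniteOp T) :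
    ∃ (n : ℕ) (a : Fin n → StrongDual 𝕜 E) (y : Fin n → F),
      T = ∑ k, (a k).smulRight (y k) := by
  obtain ⟨N, _, _, S, rfl, -⟩ := hT.exists_range_factor
  let b := Module.finBasis 𝕜 N
  refine ⟨_, fun k => (b.coord k).toContinuousLinearMap.comp S, fun k => b k, ?_⟩
  conv_lhs => rw [← sum_coord_smulRight b N.subtypeL]
  ext x
  simp

theorem finTrace_eq_trace {V : Type*} [AddCommGroup V] [Module 𝕜 V] [FiniteDimensional 𝕜 V]
    (T : E →L[𝕜] E) (A : V →ₗ[𝕜] E) (B : E →ₗ[𝕜] V) (hT : (T : E →ₗ[𝕜] E) = A ∘ₗ B) :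
    finTrace T = LinearMap.trace 𝕜 V (B ∘ₗ A) := by
  set R := LinearMap.range (T : E →ₗ[𝕜] E)
  set W := LinearMap.range A
  have hRW : R ≤ W := by
    simpa only [R, hT] using LinearMap.range_comp_le_range B A
  have : FiniteDimensional 𝕜 R := Submodule.finiteDimensional_of_le hRW
  have hW : Submodule.inclusion hRW ∘ₗ (T : E →ₗ[𝕜] E).rangeRestrict = A.rangeRestrict ∘ₗ B :=
    LinearMap.ext fun x => Subtype.ext (LinearMap.congr_fun hT x)
  calc finTrace T
      = LinearMap.trace 𝕜 R
          (((T : E →ₗ[𝕜] E).rangeRestrict ∘ₗ W.subtype) ∘ₗ Submodule.inclusion hRW) := rfl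
    _ = LinearMap.trace 𝕜 W
          ((Submodule.inclusion hRW ∘ₗ (T : E →ₗ[𝕜] E).rangeRestrict) ∘ₗ W.subtype) :=
        LinearMap.trace_comp_comm' _ _
    _ = LinearMap.trace 𝕜 W (A.rangeRestrict ∘ₗ (B ∘ₗ W.subtype)) := by
        rw [hW, LinearMap.comp_assoc]
    _ = LinearMap.trace 𝕜 V ((B ∘ₗ W.subtype) ∘ₗ A.rangeRestrict) :=
        LinearMap.trace_comp_comm' _ _

theorem finTrace_sum_smulRight {ι : Type*} [Fintype ι] (a : ι → StrongDual 𝕜 E) (y : ι → E) :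
    finTrace (∑ k, (a k).smulRight (y k)) = ∑ k, a k (y k) := by
  classical
  rw [finTrace_eq_trace _ (Fintype.linearCombination 𝕜 y)
    (LinearMap.pi fun k => (a k : E →ₗ[𝕜] 𝕜)) (by ext x; simp [Fintype.linearCombination_apply]),
    LinearMap.trace_eq_matrix_trace 𝕜 (Pi.basisFun 𝕜 ι)]
  simp [Matrix.trace]

theorem IsFiniteOp.exists_finTrace_comp_eq_sum {L : F →L[𝕜] G} (hL : IsFiniteOp L) :
    ∃ (n : ℕ) (a : Fin n → StrongDual 𝕜 F) (y : Fin n → G),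
      ∀ T : G →L[𝕜] F, finTrace (T.comp L) = ∑ k, a k (T (y k)) := by
  obtain ⟨n, a, y, rfl⟩ := hL.exists_eq_sum_smulRight
  refine ⟨n, a, y, fun T => ?_⟩
  rw [← finTrace_sum_smulRight]
  congr 1
  ext x
  simp

theorem exists_finTrace_comp_eq [FiniteDimensional 𝕜 E] (f : StrongDual 𝕜 (E →L[𝕜] F)) :
    ∃ U : F →L[𝕜] E, ∀ T : E →L[𝕜] F, finTrace (U.comp T) = f T := by
  let b := Module.finBasis 𝕜 E
  let β : Fin _ → StrongDual 𝕜 E := fun k => (b.coord k).toContinuousLinearMap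
  let g : Fin _ → StrongDual 𝕜 F := fun k => f.comp (ContinuousLinearMap.smulRightL 𝕜 E F (β k))
  refine ⟨∑ k, (g k).smulRight (b k), fun T => ?_⟩
  have hUT : (∑ k, (g k).smulRight (b k)).comp T = ∑ k, ((g k).comp T).smulRight (b k) := by
    ext x
    simp
  calc finTrace ((∑ k, (g k).smulRight (b k)).comp T)
      = ∑ k, f ((β k).smulRight (T (b k))) := by
        rw [hUT, finTrace_sum_smulRight]
        rfl
    _ = f T := by rw [← map_sum, sum_coord_smulRight]

end FiniteTrace

section MetricApproximation

open scoped lp ENNReal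

variable {𝕜 : Type u} [RCLike 𝕜] {I E : Type u}
  [NormedAddCommGroup E] [NormedSpace 𝕜 E]

variable (𝕜 E) in
/-- The metric approximation property: the identity of `E` is approximated by finite operators of
norm at most one. Asking for this on finite sets is the same as on compact sets, since the
approximating operators are uniformly bounded. -/
def MetricApproximationProperty : Prop :=
  ∀ (s : Finset E) (ε : ℝ), 0 < ε →
    ∃ P : E →L[𝕜] E, IsFiniteOp P ∧ ‖P‖ ≤ 1 ∧ ∀ x ∈ s, ‖x - P x‖ ≤ ε

/-- The operator `x ↦ (φ i x)ᵢ` into `ℓ^∞(I)` given by a family of functionals in the dual unit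
ball. -/
noncomputable def lpPi (φ : I → StrongDual 𝕜 E) (hφ : ∀ i, ‖φ i‖ ≤ 1) : E →L[𝕜] ℓ^∞(I, 𝕜) :=
  have hle : ∀ x i, ‖φ i x‖ ≤ 1 * ‖x‖ := fun x i => (φ i).le_of_opNorm_le (hφ i) x
  LinearMap.mkContinuous
    { toFun := fun x => ⟨fun i => φ i x, memℓp_infty
        ⟨1 * ‖x‖, Set.forall_mem_range.2 (hle x)⟩⟩
      map_add' := fun x y => by ext i; exact map_add (φ i) x y
      map_smul' := fun c x => by ext i; exact map_smul (φ i) c x } 1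
    fun x => lp.norm_le_of_forall_le (mul_nonneg zero_le_one (norm_nonneg x)) (hle x)

theorem lpPi_apply (φ : I → StrongDual 𝕜 E) (hφ : ∀ i, ‖φ i‖ ≤ 1) (x : E) (i : I) :
    lpPi φ hφ x i = φ i x :=
  rfl

theorem norm_lpPi_le (φ : I → StrongDual 𝕜 E) (hφ : ∀ i, ‖φ i‖ ≤ 1) : ‖lpPi φ hφ‖ ≤ 1 :=
  ContinuousLinearMap.opNorm_le_bound _ zero_le_one fun x =>
    lp.norm_le_of_forall_le (by positivity) fun i => (φ i).le_of_opNorm_le (hφ i) x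

theorem isFiniteOp_lpPi {φ : I → StrongDual 𝕜 E} (hφ : ∀ i, ‖φ i‖ ≤ 1)
    (hfin : (Set.range φ).Finite) : IsFiniteOp (lpPi φ hφ) := by
  have := hfin.to_subtype
  let Φ : E →ₗ[𝕜] Set.range φ → 𝕜 := LinearMap.pi fun ψ => (ψ : E →ₗ[𝕜] 𝕜)
  have hker : LinearMap.ker Φ ≤ LinearMap.ker (lpPi φ hφ : E →ₗ[𝕜] ℓ^∞(I, 𝕜)) := by
    intro x hx
    ext i
    exact congrFun (LinearMap.mem_ker.1 hx) ⟨φ i, i, rfl⟩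
  exact Module.Finite.iff_fg.2
    (Submodule.range_fg_iff_ker_cofg.2 ((Submodule.CoFG.ker Φ).of_le hker))

variable (𝕜 E) in
theorem exists_linearIsometry_lp : ∃ I : Type u, Nonempty (E →ₗᵢ[𝕜] ℓ^∞(I, 𝕜)) := by
  let φ : Metric.closedBall (0 : StrongDual 𝕜 E) 1 → StrongDual 𝕜 E := (↑)
  have hφ : ∀ i, ‖φ i‖ ≤ 1 := fun i => mem_closedBall_zero_iff.1 i.2
  refine ⟨_, ⟨⟨(lpPi φ hφ).toLinearMap, fun x => le_antisymm ?_ ?_⟩⟩⟩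
  · simpa using (lpPi φ hφ).le_of_opNorm_le (norm_lpPi_le φ hφ) x
  · obtain ⟨ψ, hψ, hψx⟩ := exists_dual_vector'' 𝕜 x
    have hle := lp.norm_apply_le_norm ENNReal.top_ne_zero (lpPi φ hφ x)
      ⟨ψ, mem_closedBall_zero_iff.2 hψ⟩
    rw [lpPi_apply] at hle
    simpa [φ, hψx] using hle

theorem exists_finite_range_dist_lt {X : Type*} {I : Type*} [PseudoMetricSpace X] {v : I → X}
    (hv : TotallyBounded (Set.range v)) {ε : ℝ} (hε : 0 < ε) :
    ∃ r : I → I, (Set.range r).Finite ∧ ∀ i, dist (v i) (v (r i)) < ε := by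
  obtain ⟨t, ht, htfin, hcover⟩ := Metric.finite_approx_of_totallyBounded hv ε hε
  obtain ⟨s, -, hsfin, rfl⟩ := Set.exists_subset_image_finite_and.1
    ⟨t, by rwa [Set.image_univ], htfin, rfl⟩
  have hnear : ∀ i, ∃ j ∈ s, dist (v i) (v j) < ε := fun i => by
    simpa using hcover (Set.mem_range_self i)
  choose r hrs hr using hnear
  exact ⟨r, hsfin.subset (Set.range_subset_iff.2 hrs), hr⟩

theorem metricApproximationProperty_lp : MetricApproximationProperty 𝕜 ℓ^∞(I, 𝕜) := by
  intro s ε hε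
  let v : I → s → 𝕜 := fun i x => x.1 i
  have hbdd : Bornology.IsBounded (Set.range v) := by
    refine Bornology.forall_isBounded_image_eval_iff.1 fun x =>
      isBounded_iff_forall_norm_le.2 ⟨‖x.1‖, ?_⟩
    rintro _ ⟨_, ⟨i, rfl⟩, rfl⟩
    exact lp.norm_apply_le_norm ENNReal.top_ne_zero x.1 i
  have htb : TotallyBounded (Set.range v) :=
    (Metric.isCompact_of_isClosed_isBounded isClosed_closure hbdd.closure).totallyBounded.subset
      subset_closure
  obtain ⟨r, hr, hdist⟩ := exists_finite_range_dist_lt htb hε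
  let ev : I → StrongDual 𝕜 ℓ^∞(I, 𝕜) := fun i => lp.evalCLM 𝕜 (fun _ => 𝕜) ∞ i
  have hev : ∀ i, ‖ev (r i)‖ ≤ 1 := fun _ => LinearMap.mkContinuous_norm_le _ zero_le_one _
  refine ⟨lpPi (ev ∘ r) hev, isFiniteOp_lpPi (φ := ev ∘ r) hev (Set.range_comp ev r ▸ hr.image ev),
    norm_lpPi_le _ hev, fun x hx => lp.norm_le_of_forall_le hε.le fun i => ?_⟩
  have hi := (dist_le_pi_dist (v i) (v (r i)) ⟨x, hx⟩).trans (hdist i).le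
  rwa [dist_eq_norm] at hi

end MetricApproximation

theorem exists_strongDual_eq_seminorm {𝕜 V : Type*} [RCLike 𝕜] [AddCommGroup V] [Module 𝕜 V]
    [TopologicalSpace V] [PolynormableSpace 𝕜 V] {p : Seminorm 𝕜 V} (hp : Continuous p) (x : V) :
    ∃ f : StrongDual 𝕜 V, f x = p x ∧ ∀ y, ‖f y‖ ≤ p y := by
  rcases eq_or_ne x 0 with rfl | hx
  · exact ⟨0, by simp, by simp⟩
  let coord := (LinearEquiv.coord 𝕜 V x hx).toLinearMap
  have hcoord : ∀ y, ‖((p x : 𝕜) • coord) y‖ ≤ p y := fun y => by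
    conv_rhs => rw [← LinearEquiv.coord_apply_smul 𝕜 V x hx y, map_smul_eq_mul]
    rw [LinearMap.smul_apply, norm_smul, RCLike.norm_ofReal, abs_of_nonneg (apply_nonneg p x),
      mul_comm]
    rfl
  obtain ⟨f, hfx, hf⟩ := Module.Dual.exists_continuous_extension_of_le_seminorm _ _ hp hcoord
  refine ⟨f, ?_, hf⟩
  have hx1 : coord ⟨x, Submodule.mem_span_singleton_self x⟩ = 1 :=
    LinearEquiv.coord_self 𝕜 V x hx
  rw [hfx ⟨x, Submodule.mem_span_singleton_self x⟩, LinearMap.smul_apply, hx1, smul_eq_mul,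
    mul_one]

namespace BanachIdeal

variable {𝕜 : Type u} [RCLike 𝕜] (A : BanachIdeal 𝕜)

section Ideal

variable {E F G : Type u}
  [NormedAddCommGroup E] [NormedSpace 𝕜 E] [CompleteSpace E]
  [NormedAddCommGroup F] [NormedSpace 𝕜 F] [CompleteSpace F]
  [NormedAddCommGroup G] [NormedSpace 𝕜 G] [CompleteSpace G]

theorem mem_postcomp (S : F →L[𝕜] G) {T : E →L[𝕜] F} (hT : A.mem T) : A.mem (S.comp T) :=
  A.mem_comp S T (ContinuousLinearMap.id 𝕜 E) hT

theorem mem_zero : A.mem (0 : E →L[𝕜] F) := by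
  refine A.mem_of_isFiniteOp 0 ?_
  rw [IsFiniteOp, ContinuousLinearMap.toLinearMap_zero, LinearMap.range_zero]
  infer_instance

theorem nrm_zero : A.nrm (0 : E →L[𝕜] F) = 0 := by
  simpa only [zero_smul, norm_zero, zero_mul] using A.nrm_smul (0 : 𝕜) (0 : E →L[𝕜] F) A.mem_zero

theorem nrm_nonneg {T : E →L[𝕜] F} (hT : A.mem T) : 0 ≤ A.nrm T := by
  have h := A.nrm_add_le T ((-1 : 𝕜) • T) hT (A.mem_smul _ _ hT)
  rw [A.nrm_smul _ _ hT, neg_one_smul, add_neg_cancel, A.nrm_zero, norm_neg, norm_one] at h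
  linarith

theorem nrm_postcomp_le (S : F →L[𝕜] G) {T : E →L[𝕜] F} (hT : A.mem T) :
    A.nrm (S.comp T) ≤ ‖S‖ * A.nrm T :=
  (A.nrm_comp_le S T (ContinuousLinearMap.id 𝕜 E) hT).trans <|
    mul_le_of_le_one_right (mul_nonneg (norm_nonneg S) (A.nrm_nonneg hT))
      ContinuousLinearMap.norm_id_le

theorem nrm_postcomp_le_of_norm_le_one {S : F →L[𝕜] G} (hS : ‖S‖ ≤ 1) {T : E →L[𝕜] F}
    (hT : A.mem T) : A.nrm (S.comp T) ≤ A.nrm T :=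
  (A.nrm_postcomp_le S hT).trans (mul_le_of_le_one_left (A.nrm_nonneg hT) hS)

end Ideal

section AdjointConjugate

variable {E F G : Type u}
  [NormedAddCommGroup E] [NormedSpace 𝕜 E] [CompleteSpace E]
  [NormedAddCommGroup F] [NormedSpace 𝕜 F] [CompleteSpace F]
  [NormedAddCommGroup G] [NormedSpace 𝕜 G] [CompleteSpace G]

theorem adjointBound_of_conjugateBound {T : E →L[𝕜] F} {c : ℝ} (h : A.ConjugateBound T c) :
    A.AdjointBound T c := by
  refine ⟨h.1, fun E₀ F₀ _ _ _ _ _ _ P S Q hP hS _ => ?_⟩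
  calc ‖finTrace (T.comp (P.comp (S.comp Q)))‖
      ≤ c * A.nrm (P.comp (S.comp Q)) := h.2 _ (hP.precomp _)
    _ ≤ c * (‖P‖ * A.nrm S * ‖Q‖) := mul_le_mul_of_nonneg_left (A.nrm_comp_le P S Q hS) h.1
    _ = c * ‖P‖ * A.nrm S * ‖Q‖ := by ring

theorem norm_finTrace_comp_le_of_finiteDimensional (hleft : A.IsLeftAccessible)
    {T : E →L[𝕜] F} {c : ℝ} (hT : A.AdjointBound T c) [FiniteDimensional 𝕜 G]
    (R : G →L[𝕜] E) (S : F →L[𝕜] G) :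
    ‖finTrace (T.comp (R.comp S))‖ ≤ c * ‖R‖ * A.nrm S := by
  have hS := A.nrm_nonneg (A.mem_of_isFiniteOp S (.of_finiteDimensional_codomain S))
  have hc : 0 ≤ c * ‖R‖ := mul_nonneg hT.1 (norm_nonneg R)
  refine (le_iff_forall_one_lt_le_mul₀ (mul_nonneg hc hS)).2 fun t ht => ?_
  obtain ⟨K, _, _, S', hS', hfac, hnrm⟩ := hleft _ _ S (t - 1) (sub_pos.2 ht)
  have hQ : ‖K.mkQL‖ ≤ 1 := ContinuousLinearMap.opNorm_le_bound _ zero_le_one fun x =>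
    (Submodule.Quotient.norm_mk_le K x).trans_eq (one_mul _).symm
  rw [add_sub_cancel] at hnrm
  calc ‖finTrace (T.comp (R.comp S))‖
      = ‖finTrace (T.comp (R.comp (S'.comp K.mkQL)))‖ := by rw [← hfac]
    _ ≤ c * ‖R‖ * A.nrm S' * ‖K.mkQL‖ := hT.2 _ _ R S' K.mkQL
        (.of_finiteDimensional_domain R) hS' (.of_finiteDimensional_codomain _)
    _ ≤ c * ‖R‖ * A.nrm S' := mul_le_of_le_one_right (mul_nonneg hc (A.nrm_nonneg hS')) hQ
    _ ≤ c * ‖R‖ * (t * A.nrm S) := mul_le_mul_of_nonneg_left hnrm hc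
    _ = c * ‖R‖ * A.nrm S * t := by ring

theorem norm_finTrace_comp_le_of_isFiniteOp (hleft : A.IsLeftAccessible)
    {T : E →L[𝕜] F} {c : ℝ} (hT : A.AdjointBound T c) {P : G →L[𝕜] E} (hP : IsFiniteOp P)
    {L : F →L[𝕜] G} (hL : A.mem L) :
    ‖finTrace (T.comp (P.comp L))‖ ≤ c * (‖P‖ * A.nrm L) := by
  obtain ⟨N, _, _, S, rfl, hS⟩ := hP.exists_range_factor
  calc ‖finTrace (T.comp ((N.subtypeL.comp S).comp L))‖
      ≤ c * ‖N.subtypeL‖ * A.nrm (S.comp L) :=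
        A.norm_finTrace_comp_le_of_finiteDimensional hleft hT N.subtypeL (S.comp L)
    _ ≤ c * A.nrm (S.comp L) :=
        mul_le_mul_of_nonneg_right (mul_le_of_le_one_right hT.1 N.norm_subtypeL_le)
          (A.nrm_nonneg (A.mem_postcomp S hL))
    _ ≤ c * (‖N.subtypeL.comp S‖ * A.nrm L) :=
        mul_le_mul_of_nonneg_left ((A.nrm_postcomp_le S hL).trans
          (mul_le_mul_of_nonneg_right hS (A.nrm_nonneg hL))) hT.1

theorem conjugateBound_of_metricApproximationProperty (hleft : A.IsLeftAccessible)
    (hE : MetricApproximationProperty 𝕜 E) {T : E →L[𝕜] F} {c : ℝ} (hT : A.AdjointBound T c) :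
    A.ConjugateBound T c := by
  classical
  refine ⟨hT.1, fun L hL => le_of_forall_pos_le_add fun δ hδ => ?_⟩
  have hLmem := A.mem_of_isFiniteOp L hL
  obtain ⟨n, a, y, htrace⟩ := hL.exists_finTrace_comp_eq_sum
  obtain ⟨ε, hε, hεδ⟩ := exists_pos_mul_lt hδ (∑ k, ‖a k‖ * ‖T‖)
  obtain ⟨P, hP, hP1, hPy⟩ := hE (Finset.univ.image y) ε hε
  have herror : ‖finTrace (T.comp L) - finTrace (T.comp (P.comp L))‖ ≤ δ :=
    calc ‖finTrace (T.comp L) - finTrace (T.comp (P.comp L))‖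
        = ‖∑ k, a k (T (y k - P (y k)))‖ := by
          rw [← ContinuousLinearMap.comp_assoc, htrace, htrace, ← Finset.sum_sub_distrib]
          simp only [ContinuousLinearMap.comp_apply, map_sub]
      _ ≤ ∑ k, ‖a k‖ * (‖T‖ * ε) := norm_sum_le_of_le _ fun k _ =>
          (a k).le_opNorm_of_le (T.le_opNorm_of_le
            (hPy _ (Finset.mem_image_of_mem y (Finset.mem_univ k))))
      _ = (∑ k, ‖a k‖ * ‖T‖) * ε := by simp only [Finset.sum_mul, mul_assoc]
      _ ≤ δ := hεδ.le
  have happrox : ‖finTrace (T.comp (P.comp L))‖ ≤ c * A.nrm L :=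
    (A.norm_finTrace_comp_le_of_isFiniteOp hleft hT hP hLmem).trans
      (mul_le_mul_of_nonneg_left (mul_le_of_le_one_left (A.nrm_nonneg hLmem) hP1) hT.1)
  linarith [norm_le_norm_add_norm_sub' (finTrace (T.comp L)) (finTrace (T.comp (P.comp L)))]

theorem adjointBound_nrm {T : E →L[𝕜] F} (hT : A.adjoint.mem T) :
    A.AdjointBound T (A.adjoint.nrm T) := by
  have hbelow : BddBelow {c | A.AdjointBound T c} := ⟨0, fun _ h => h.1⟩
  obtain ⟨c, -, hlim, hc⟩ := exists_seq_tendsto_sInf hT hbelow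
  refine ⟨Real.sInf_nonneg fun _ h => h.1, fun E₀ F₀ _ _ _ _ _ _ P S Q hP hS hQ => ?_⟩
  exact ge_of_tendsto' (((hlim.mul_const _).mul_const _).mul_const _)
    fun n => (hc n).2 E₀ F₀ P S Q hP hS hQ

theorem conjugateBound_of_adjointBound (hleft : A.IsLeftAccessible)
    (hEP : A.adjoint.ExtensionProperty) {T : E →L[𝕜] F} {c : ℝ} (hT : A.AdjointBound T c) :
    A.ConjugateBound T c := by
  refine ⟨hT.1, fun L hL => ?_⟩
  have hLmem := A.mem_of_isFiniteOp L hL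
  have hL0 := A.nrm_nonneg hLmem
  refine (le_iff_forall_one_lt_le_mul₀ (mul_nonneg hT.1 hL0)).2 fun t ht => ?_
  obtain ⟨I, ⟨J⟩⟩ := exists_linearIsometry_lp 𝕜 E
  obtain ⟨T', hT', hfac, hnrm⟩ := hEP _ _ _ (t - 1) J T (sub_pos.2 ht) ⟨c, hT⟩
  have hT'conj := A.conjugateBound_of_metricApproximationProperty hleft
    metricApproximationProperty_lp (A.adjointBound_nrm hT')
  have hTc : A.adjoint.nrm T ≤ c := csInf_le ⟨0, fun _ h => h.1⟩ hT
  rw [add_sub_cancel] at hnrm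
  calc ‖finTrace (T.comp L)‖
      = ‖finTrace (T'.comp (J.toContinuousLinearMap.comp L))‖ := by
        rw [hfac, ContinuousLinearMap.comp_assoc]
    _ ≤ A.adjoint.nrm T' * A.nrm (J.toContinuousLinearMap.comp L) :=
        hT'conj.2 _ (hL.postcomp _)
    _ ≤ A.adjoint.nrm T' * A.nrm L :=
        mul_le_mul_of_nonneg_left
          (A.nrm_postcomp_le_of_norm_le_one J.norm_toContinuousLinearMap_le hLmem) hT'conj.1
    _ ≤ t * c * A.nrm L := by gcongr; exact hnrm.trans (by gcongr)
    _ = c * A.nrm L * t := by ring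

theorem adjoint_eq_conjugate (hleft : A.IsLeftAccessible) (hEP : A.adjoint.ExtensionProperty) :
    A.adjoint = A.conjugate := by
  have hbound : ∀ {E F : Type u} [NormedAddCommGroup E] [NormedSpace 𝕜 E] [CompleteSpace E]
      [NormedAddCommGroup F] [NormedSpace 𝕜 F] [CompleteSpace F] (T : E →L[𝕜] F) (c : ℝ),
      A.AdjointBound T c ↔ A.ConjugateBound T c := fun _ _ =>
    ⟨A.conjugateBound_of_adjointBound hleft hEP, A.adjointBound_of_conjugateBound⟩
  simp only [OpClass.adjoint, OpClass.conjugate, hbound]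

end AdjointConjugate

section RightAccessible

open scoped Pointwise

variable {E F : Type u} [NormedAddCommGroup E] [NormedSpace 𝕜 E] [CompleteSpace E]
  [NormedAddCommGroup F] [NormedSpace 𝕜 F]

/-- `T` factors through the inclusion of a finite-dimensional subspace of `F`, with a first factor
of ideal norm at most `r`. Right-accessibility says that, for operators `T` with finite-dimensional
domain, the infimum of such `r` is at most the ideal norm of `T`. -/
def SubspaceBound (T : E →L[𝕜] F) (r : ℝ) : Prop :=
  ∃ (N : Submodule 𝕜 F) (_ : FiniteDimensional 𝕜 N) (_ : CompleteSpace N) (S : E →L[𝕜] N),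
    T = N.subtypeL.comp S ∧ A.nrm S ≤ r

variable {A}

theorem SubspaceBound.nonneg {T : E →L[𝕜] F} {r : ℝ} (h : A.SubspaceBound T r) : 0 ≤ r :=
  let ⟨_, _, _, S, _, hr⟩ := h
  (A.nrm_nonneg (A.mem_of_isFiniteOp S (.of_finiteDimensional_codomain S))).trans hr

variable (A) in
theorem subspaceBound_zero : A.SubspaceBound (0 : E →L[𝕜] F) 0 :=
  ⟨⊥, inferInstance, inferInstance, 0, by rw [ContinuousLinearMap.comp_zero], A.nrm_zero.le⟩

theorem SubspaceBound.add {T₁ T₂ : E →L[𝕜] F} {r₁ r₂ : ℝ} (h₁ : A.SubspaceBound T₁ r₁)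
    (h₂ : A.SubspaceBound T₂ r₂) : A.SubspaceBound (T₁ + T₂) (r₁ + r₂) := by
  obtain ⟨N₁, _, _, S₁, rfl, hr₁⟩ := h₁
  obtain ⟨N₂, _, _, S₂, rfl, hr₂⟩ := h₂
  let N := N₁ ⊔ N₂
  have : CompleteSpace N := FiniteDimensional.complete 𝕜 N
  let i₁ : N₁ →L[𝕜] N := N₁.subtypeL.codRestrict N fun x => Submodule.mem_sup_left x.2
  let i₂ : N₂ →L[𝕜] N := N₂.subtypeL.codRestrict N fun x => Submodule.mem_sup_right x.2
  have hi₁ : ‖i₁‖ ≤ 1 := i₁.opNorm_le_bound zero_le_one fun x => (one_mul ‖x‖).ge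
  have hi₂ : ‖i₂‖ ≤ 1 := i₂.opNorm_le_bound zero_le_one fun x => (one_mul ‖x‖).ge
  have hS₁ := A.mem_of_isFiniteOp S₁ (.of_finiteDimensional_codomain S₁)
  have hS₂ := A.mem_of_isFiniteOp S₂ (.of_finiteDimensional_codomain S₂)
  refine ⟨N, inferInstance, this, i₁.comp S₁ + i₂.comp S₂, rfl, ?_⟩
  calc A.nrm (i₁.comp S₁ + i₂.comp S₂)
      ≤ A.nrm (i₁.comp S₁) + A.nrm (i₂.comp S₂) :=
        A.nrm_add_le _ _ (A.mem_postcomp i₁ hS₁) (A.mem_postcomp i₂ hS₂)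
    _ ≤ r₁ + r₂ := add_le_add
        ((A.nrm_postcomp_le_of_norm_le_one hi₁ hS₁).trans hr₁)
        ((A.nrm_postcomp_le_of_norm_le_one hi₂ hS₂).trans hr₂)

theorem SubspaceBound.smul (c : 𝕜) {T : E →L[𝕜] F} {r : ℝ} (h : A.SubspaceBound T r) :
    A.SubspaceBound (c • T) (‖c‖ * r) := by
  obtain ⟨N, hN, hNc, S, rfl, hr⟩ := h
  refine ⟨N, hN, hNc, c • S, (ContinuousLinearMap.comp_smul _ _ _).symm, ?_⟩
  rw [A.nrm_smul c S (A.mem_of_isFiniteOp S (.of_finiteDimensional_codomain S))]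
  exact mul_le_mul_of_nonneg_left hr (norm_nonneg c)

variable (A) in
theorem subspaceBound_comp {E₀ F₀ : Type u}
    [NormedAddCommGroup E₀] [NormedSpace 𝕜 E₀] [CompleteSpace E₀]
    [NormedAddCommGroup F₀] [NormedSpace 𝕜 F₀] [CompleteSpace F₀]
    {P : E₀ →L[𝕜] F} (hP : IsFiniteOp P) {S : F₀ →L[𝕜] E₀} (hS : A.mem S) (Q : E →L[𝕜] F₀) :
    A.SubspaceBound (P.comp (S.comp Q)) (‖P‖ * A.nrm S * ‖Q‖) := by
  obtain ⟨N, hN, hNc, P', hfac, hP'⟩ := hP.exists_range_factor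
  refine ⟨N, hN, hNc, P'.comp (S.comp Q), by rw [hfac, ContinuousLinearMap.comp_assoc], ?_⟩
  refine (A.nrm_comp_le P' S Q hS).trans ?_
  have := A.nrm_nonneg hS
  gcongr

variable [FiniteDimensional 𝕜 E]

variable (A) in
theorem subspaceBound_opNorm (T : E →L[𝕜] F) :
    A.SubspaceBound T
      (‖T‖ * A.nrm (ContinuousLinearMap.id 𝕜 E) * ‖ContinuousLinearMap.id 𝕜 E‖) :=
  A.subspaceBound_comp (.of_finiteDimensional_domain T)
    (A.mem_of_isFiniteOp (.id 𝕜 E) (.of_finiteDimensional_domain _)) (.id 𝕜 E)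

variable (A E F) in
/-- The infimum of the ideal norms of the first factors of `T : E →L[𝕜] F` through
finite-dimensional subspaces of `F`; the domain `E` is finite-dimensional, so that such
factorizations exist. -/
noncomputable def subspaceSeminorm : Seminorm 𝕜 (E →L[𝕜] F) :=
  have bddBelow : ∀ T : E →L[𝕜] F, BddBelow {r | A.SubspaceBound T r} := fun _ =>
    ⟨0, fun _ h => h.nonneg⟩
  have nonempty : ∀ T : E →L[𝕜] F, {r | A.SubspaceBound T r}.Nonempty := fun T =>
    ⟨_, A.subspaceBound_opNorm T⟩
  Seminorm.ofSMulLE (fun T => sInf {r | A.SubspaceBound T r})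
    (le_antisymm (csInf_le (bddBelow 0) A.subspaceBound_zero)
      (Real.sInf_nonneg fun _ h => h.nonneg))
    (fun T₁ T₂ => by
      rw [← csInf_add (nonempty T₁) (bddBelow T₁) (nonempty T₂) (bddBelow T₂)]
      refine csInf_le_csInf (bddBelow _) ((nonempty T₁).add (nonempty T₂)) ?_
      rintro _ ⟨r₁, h₁, r₂, h₂, rfl⟩
      exact SubspaceBound.add h₁ h₂)
    (fun c T => by
      rw [← smul_eq_mul, ← Real.sInf_smul_of_nonneg (norm_nonneg c)]
      refine csInf_le_csInf (bddBelow _) (nonempty T).smul_set ?_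
      rintro _ ⟨r, hr, rfl⟩
      exact SubspaceBound.smul c hr)

theorem SubspaceBound.subspaceSeminorm_le {T : E →L[𝕜] F} {r : ℝ} (h : A.SubspaceBound T r) :
    A.subspaceSeminorm E F T ≤ r :=
  csInf_le ⟨0, fun _ h => h.nonneg⟩ h

theorem exists_subspaceBound_lt {T : E →L[𝕜] F} {r : ℝ} (h : A.subspaceSeminorm E F T < r) :
    ∃ s < r, A.SubspaceBound T s :=
  have nonempty : {r | A.SubspaceBound T r}.Nonempty := ⟨_, A.subspaceBound_opNorm T⟩
  let ⟨s, hs, hsr⟩ := exists_lt_of_csInf_lt nonempty h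
  ⟨s, hsr, hs⟩

variable (A E F) in
theorem continuous_subspaceSeminorm : Continuous (A.subspaceSeminorm E F) := by
  have hid := A.nrm_nonneg (A.mem_of_isFiniteOp (.id 𝕜 E) (.of_finiteDimensional_domain _))
  let C : NNReal := ⟨A.nrm (.id 𝕜 E) * ‖ContinuousLinearMap.id 𝕜 E‖, by positivity⟩
  refine Seminorm.continuous_of_le (q := C • normSeminorm 𝕜 (E →L[𝕜] F))
    (continuous_norm.const_smul C) fun T => ?_
  calc A.subspaceSeminorm E F T
      ≤ ‖T‖ * A.nrm (.id 𝕜 E) * ‖ContinuousLinearMap.id 𝕜 E‖ :=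
        (A.subspaceBound_opNorm T).subspaceSeminorm_le
    _ = C * ‖T‖ := by rw [mul_assoc, mul_comm]; rfl

variable [CompleteSpace F]

theorem subspaceSeminorm_le_nrm
    (hconj : ∀ (U : F →L[𝕜] E) (c : ℝ), A.AdjointBound U c → A.ConjugateBound U c)
    (T : E →L[𝕜] F) : A.subspaceSeminorm E F T ≤ A.nrm T := by
  obtain ⟨f, hfT, hf⟩ := exists_strongDual_eq_seminorm (A.continuous_subspaceSeminorm E F) T
  obtain ⟨U, hU⟩ := exists_finTrace_comp_eq f
  have hadj : A.AdjointBound U 1 := by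
    refine ⟨zero_le_one, fun E₀ F₀ _ _ _ _ _ _ P S Q hP hS _ => ?_⟩
    rw [hU, one_mul]
    exact (hf _).trans (A.subspaceBound_comp hP hS Q).subspaceSeminorm_le
  calc A.subspaceSeminorm E F T = ‖finTrace (U.comp T)‖ := by
        rw [hU, hfT, RCLike.norm_ofReal, abs_of_nonneg (apply_nonneg _ T)]
    _ ≤ 1 * A.nrm T := (hconj U 1 hadj).2 T (.of_finiteDimensional_domain T)
    _ = A.nrm T := one_mul _

end RightAccessible

theorem isRightAccessible (hleft : A.IsLeftAccessible) (hEP : A.adjoint.ExtensionProperty) :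
    A.IsRightAccessible := by
  intro M F _ _ _ _ _ _ _ T ε hε
  have hT : A.mem T := A.mem_of_isFiniteOp T (.of_finiteDimensional_domain T)
  rcases (A.nrm_nonneg hT).eq_or_lt with hT0 | hTpos
  · obtain rfl := A.eq_zero_of_nrm_eq_zero T hT hT0.symm
    refine ⟨⊥, inferInstance, inferInstance, 0, A.mem_zero, ?_, ?_⟩
    · rw [ContinuousLinearMap.comp_zero]
    · rw [A.nrm_zero, A.nrm_zero, mul_zero]
  · have hlt : A.subspaceSeminorm M F T < (1 + ε) * A.nrm T :=
      (subspaceSeminorm_le_nrm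
        (fun _ _ => A.conjugateBound_of_adjointBound hleft hEP) T).trans_lt
        (lt_mul_of_one_lt_left hTpos (lt_add_of_pos_right 1 hε))
    obtain ⟨r, hr, N, hN, hNc, S, hfac, hS⟩ := exists_subspaceBound_lt hlt
    exact ⟨N, hN, hNc, S, A.mem_of_isFiniteOp S (.of_finiteDimensional_codomain S), hfac,
      hS.trans hr.le⟩

end BanachIdeal

theorem theorem4p7_general {𝕜 : Type u} [RCLike 𝕜] (A : BanachIdeal 𝕜)
    (hleft : A.IsLeftAccessible) (hEP : A.adjoint.ExtensionProperty) :
    A.IsAccessible ∧ A.conjugate.conjugate.IsometricEq A.adjoint.conjugate := by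
  refine ⟨⟨A.isRightAccessible hleft hEP, hleft⟩, ?_⟩
  rw [A.adjoint_eq_conjugate hleft hEP]
  exact fun _ _ _ _ _ _ _ _ _ => ⟨Iff.rfl, fun _ => rfl⟩

theorem theorem4p7 {𝕜 : Type u} [RCLike 𝕜] (A : BanachIdeal 𝕜)
    (hmax : A.IsMaximal) (hleft : A.IsLeftAccessible)
    (hEP : A.adjoint.ExtensionProperty) :
    A.IsAccessible ∧ A.conjugate.conjugate.IsometricEq A.adjoint.conjugate :=
  theorem4p7_general A hleft hEP
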